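/- **Theorem 2.4 (Bayesian–Sanov theorem for Pólya sampling).** Let $\mathcal X$ be a finite set, let $\mathcal P(\mathcal X)$ be the set of probability mass functions on $\mathcal X$ with $q_i>0$ for all $i\in\mathcal X$, regarded as a subset of the probability simplex with its usual topology, let $c\in\mathbb Z$ and $\beta\in(0,1)$. *Urn.* For a configuration $\alpha\in\mathbb Z_{\ge 0}^{\mathcal X}$ of $N=\sum_i\alpha_i$ balls, an ordered sample $x$ of size $n$ in which colour $i$ occurs $n_i$ times is drawn from the Pólya urn with parameter $c$ with probability $$\Pi(x\mid\alpha;c)=\frac{\prod_{i\in\mathcal X}\prod_{l=0}^{n_i-1}(\alpha_i+lc)}{\prod_{l=0}^{n-1}(N+lc)} ;$$ this is meaningful if $-nc\le\min_i\alpha_i$. For a subset $A$ of the simplex, let $A(N)$ be the set of configurations $\alpha$ of $N$ balls with $\alpha/N\in A$. *Divergence.* For $p,q\in\mathcal P(\mathcal X)$ put, for $c\ne0$, $$L^c_\beta(q\|p)=-\sum_i p_i\log(q_i+\beta c p_i)+\frac1{\beta c}\sum_i q_i\log\frac{q_i}{q_i+\beta c p_i},\qquad L^0_\beta(q\|p)=-\sum_i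 p_i\log q_i-1,$$ and $L^c_\beta(A\|p)=\inf_{q\in A}L^c_\beta(q\|p)$ (with $\inf\emptyset=\infty$). *Setting.* Let $Q\subseteq\Phi\subseteq\mathcal P(\mathcal X)$ be open, and let $N=N(n)$ satisfy $n/N(n)\to\beta$ as $n\to\infty$. For each $n$ let $r(N)$ be (the vector of proportions of) the true initial configuration of $N(n)$ balls, and let $r(N)\to r\in\mathcal P(\mathcal X)$ in total variation. Assume that for all large $n$ sampling $n$ balls is meaningful for the true configuration and for every configuration in $\Phi(N)$. For each $n$ let $\pi_n$ be a prior distribution of the initial configuration whose support is $\Phi(N(n))$ for all large $n$, and assume that it is not exponentially small on any open set: for every nonempty open $G\subseteq\Phi$ and every $\varepsilon>0$, $\pi_n(G(N(n)))\ge e^{-\varepsilon n}$ for all large $n$. (The uniform prior on $\Phi(N)$ is an example.) Let $X_1^n$, $n\ge1$, be samples on one probability space such that, for all large $n$, $X_1^n$ is a sample of size $n$ from the Pólya urn with the true initial configuration of $N(n)$ balls; the joint distribution of the samples for different $n$ is arbitrary. The posterior is $$\Pi_n(Q\mid X_1^n)=\frac{\sum_{\alpha\in Q(N)}\pi_n(\alpha)\,\Pi(X_1^n\mid\alpha;c)}{\sum_{\alpha\in\Phi(N)}\pi_n(\alpha)\,\Pi(X_1^n\mid\alpha;c)}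 .$$ *Claim.* If $L^c_\beta(Q\|r)<\infty$, then with probability one $\Pi_n(Q\mid X_1^n)>0$ for all large $n$ and $$\lim_{n\to\infty}\frac1n\log\Pi_n(Q\mid X_1^n)=-\bigl(L^c_\beta(Q\|r)-L^c_\beta(\Phi\|r)\bigr).$$ -/

import Mathlib

open Filter Topology MeasureTheory

namespace PolyaUrn

noncomputable section

variable {𝒳 : Type*} [Fintype 𝒳] [DecidableEq 𝒳]

/-- The probability mass functions on `𝒳` whose support is all of `𝒳`, as a subset of the
probability simplex. -/
def fullSupport (𝒳 : Type*) [Fintype 𝒳] : Set (stdSimplex ℝ 𝒳) :=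
  {q | ∀ i, 0 < (q : 𝒳 → ℝ) i}

/-- `configs A N`: the configurations `α` (numbers of balls of each colour) of an urn with `N`
balls such that the vector of proportions `α / N` belongs to `A`. -/
def configs (A : Set (stdSimplex ℝ 𝒳)) (N : ℕ) : Finset (𝒳 → ℕ) := by
  classical
  exact (Finset.piAntidiag Finset.univ N).filter
    (fun α => ∃ q ∈ A, ∀ i, (q : 𝒳 → ℝ) i = (α i : ℝ) / N)

/-- The number of occurrences of the colour `i` in the sample `x`. -/
def count {n : ℕ} (x : Fin n → 𝒳) (i : 𝒳) : ℕ :=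
  (Finset.univ.filter (fun k => x k = i)).card

/-- The probability of drawing the ordered sample `x` from a Pólya urn with initial
configuration `α` and parameter `c` (after each draw the ball is put back together with `c`
further balls of its colour; `c < 0` means removal). -/
def sampleProb (c : ℤ) (α : 𝒳 → ℕ) {n : ℕ} (x : Fin n → 𝒳) : ℝ :=
  (∏ i, ∏ l ∈ Finset.range (count x i), ((α i : ℝ) + l * c)) /
    ∏ l ∈ Finset.range n, ((∑ i, (α i : ℝ)) + l * c)

/-- The sampling of `n` balls from the configuration `α` is meaningful: `-n c ≤ min α`. -/
def Meaningful (c : ℤ) (n : ℕ) (α : 𝒳 → ℕ) : Prop :=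
  ∀ i, -((n : ℤ) * c) ≤ (α i : ℤ)

/-- Prior probability that the proportions of the `N`-urn lie in `A`. -/
def priorMass (π : PMF (𝒳 → ℕ)) (N : ℕ) (A : Set (stdSimplex ℝ 𝒳)) : ℝ :=
  ∑ α ∈ configs A N, (π α).toReal

/-- Posterior probability that the initial proportions of the `N`-urn lie in `Q`, given the
sample `x`, for a prior `π` with support `configs Φ N`. -/
def posterior (c : ℤ) (π : PMF (𝒳 → ℕ)) (N : ℕ) (Φ Q : Set (stdSimplex ℝ 𝒳))
    {n : ℕ} (x : Fin n → 𝒳) : ℝ :=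
  (∑ α ∈ configs Q N, (π α).toReal * sampleProb c α x) /
    ∑ α ∈ configs Φ N, (π α).toReal * sampleProb c α x

/-- The Pólya `L`-divergence of `q` with respect to `p`. -/
def polyaL (β : ℝ) (c : ℤ) (q p : stdSimplex ℝ 𝒳) : ℝ :=
  if c = 0 then
    -(∑ i, (p : 𝒳 → ℝ) i * Real.log ((q : 𝒳 → ℝ) i)) - 1
  else
    -(∑ i, (p : 𝒳 → ℝ) i * Real.log ((q : 𝒳 → ℝ) i + β * c * (p : 𝒳 → ℝ) i)) +
      1 / (β * c) * ∑ i, (q : 𝒳 → ℝ) i *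
        Real.log ((q : 𝒳 → ℝ) i / ((q : 𝒳 → ℝ) i + β * c * (p : 𝒳 → ℝ) i))

/-- The value of the divergence of a set `A`, i.e. the infimum of `polyaL β c q p` over
`q ∈ A`, as an extended real (`⊤` for the empty set). -/
def polyaLSet (β : ℝ) (c : ℤ) (A : Set (stdSimplex ℝ 𝒳)) (p : stdSimplex ℝ 𝒳) : EReal :=
  ⨅ q ∈ A, (polyaL β c q p : EReal)

end

end PolyaUrn

/-! ## The Bayesian Sanov theorem for Pólya sampling -/

namespace PolyaUrn

set_option linter.unusedSectionVars false

variable {𝒳 : Type*} [Fintype 𝒳] [DecidableEq 𝒳]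

/-! ### Sums of logarithms along an arithmetic progression -/

/-! In the posterior, the denominators of `sampleProb` depend on the configuration only through `N`
and cancel. What remains is a ratio of two prior-weighted sums of products over arithmetic
progressions. The logarithm of such a product is a Riemann sum for the integral of `log`, with error
`O(log n)`; so once the sample frequencies tend to `r`, the normalised log-likelihood is uniformly
close to `rate β c r q` (`logLik_uniform_of_ne`, `logLik_uniform_zero`). Laplace's principle
(`tendsto_log_sum_configs`) turns each sum into `exp (n * sup rate)`, because the prior is not
exponentially small on any nonempty open subset of `Φ`. Since `polyaL = -rate - 1` on the model
(`polyaL_eq`), the suprema become the infima of the divergence.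

The frequencies converge almost surely (`ae_tendsto_count_div`): the centred count, divided by the
current size of the urn, is a martingale with increments of order `1 / n`. This yields exponentially
small deviation probabilities, and Borel–Cantelli needs nothing about the joint law of the samples.
-/

/-- The antiderivative `x log x - x` of the logarithm. -/
noncomputable def logPrim (x : ℝ) : ℝ := x * Real.log x - x

lemma continuous_logPrim : Continuous logPrim :=
  Real.continuous_mul_log.sub continuous_id

/-- Convexity: the graph of `logPrim` lies above its tangent at `x`, whose slope is `log x`. -/
lemma mul_log_le_logPrim_sub {x y : ℝ} (hx : 0 < x) (hy : 0 < y) :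
    (y - x) * Real.log x ≤ logPrim y - logPrim x := by
  have h := Real.log_le_sub_one_of_pos (div_pos hx hy)
  rw [Real.log_div hx.ne' hy.ne'] at h
  have h2 := mul_le_mul_of_nonneg_left h hy.le
  have h3 : y * (x / y - 1) = x - y := by field_simp
  rw [h3] at h2
  unfold logPrim
  nlinarith

/-- The tangents at both ends of a step place the increment of `logPrim` between `c` times the
logarithms at the two ends, and the sum telescopes. Keeping the factor `c` instead of dividing by it
covers both signs of `c`. -/
lemma sum_log_bounds {a c : ℝ} {m : ℕ} (h : ∀ l : ℕ, l ≤ m → 0 < a + l * c) :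
    0 ≤ logPrim (a + m * c) - logPrim a - c * ∑ l ∈ Finset.range m, Real.log (a + l * c) ∧
    logPrim (a + m * c) - logPrim a - c * ∑ l ∈ Finset.range m, Real.log (a + l * c) ≤
      c * (Real.log (a + m * c) - Real.log a) := by
  induction m with
  | zero => simp
  | succ m ih =>
    have ih := ih fun l hl => h l (by omega)
    have h1 := h m (by omega)
    have h2 := h (m + 1) le_rfl
    have h3 := mul_log_le_logPrim_sub h1 h2
    have h4 := mul_log_le_logPrim_sub h2 h1
    have h5 : a + ((m + 1 : ℕ) : ℝ) * c - (a + m * c) = c := by push_cast; ring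
    have h6 : a + m * c - (a + ((m + 1 : ℕ) : ℝ) * c) = -c := by push_cast; ring
    rw [h5] at h3
    rw [h6] at h4
    rw [Finset.sum_range_succ]
    constructor <;> nlinarith [ih.1, ih.2]

lemma logPrim_mul {N u : ℝ} (hN : 0 < N) :
    logPrim (N * u) = N * logPrim u + N * u * Real.log N := by
  unfold logPrim
  rcases eq_or_ne u 0 with rfl | hu
  · simp
  · rw [Real.log_mul hN.ne' hu]; ring

/-! ### Configurations -/

lemma mem_configs {A : Set (stdSimplex ℝ 𝒳)} {N : ℕ} {α : 𝒳 → ℕ} :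
    α ∈ configs A N ↔ ∑ i, α i = N ∧ ∃ q ∈ A, ∀ i, (q : 𝒳 → ℝ) i = (α i : ℝ) / N := by
  classical
  simp [configs]

lemma sum_count {n : ℕ} (x : Fin n → 𝒳) : ∑ i, count x i = n := by
  have := Finset.card_eq_sum_card_fiberwise (f := x) (s := Finset.univ) (t := Finset.univ)
    (fun _ _ => Finset.mem_coe.2 (Finset.mem_univ _))
  simpa [count] using this.symm

lemma count_le {n : ℕ} (x : Fin n → 𝒳) (i : 𝒳) : count x i ≤ n :=
  (Finset.card_le_univ _).trans_eq (Fintype.card_fin n)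

lemma Meaningful.nonneg {c : ℤ} {n : ℕ} {α : 𝒳 → ℕ} (h : Meaningful c n α) {l : ℕ}
    (hl : l ≤ n) (i : 𝒳) : (0 : ℝ) ≤ (α i : ℝ) + l * c := by
  have h1 := h i
  have : (0 : ℤ) ≤ (α i : ℤ) + l * c := by
    have hl' : (l : ℤ) ≤ n := by exact_mod_cast hl
    rcases le_or_gt 0 c with hc | hc
    · positivity
    · nlinarith
  exact_mod_cast this

/-- For `c < 0`, meaningfulness only makes the value at `l = n` nonnegative; for `l < n` it is at
least `(n - l) * |c|`. The bound by 1 makes all logarithms of factors nonnegative. -/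
lemma Meaningful.one_le {c : ℤ} {n : ℕ} {α : 𝒳 → ℕ} (h : Meaningful c n α)
    {i : 𝒳} (hα : 0 < α i) {l : ℕ} (hl : l < n ∨ 0 ≤ c) : (1 : ℝ) ≤ (α i : ℝ) + l * c := by
  have h1 := h i
  have : (1 : ℤ) ≤ (α i : ℤ) + l * c := by
    have hα' : (1 : ℤ) ≤ α i := by exact_mod_cast hα
    rcases le_or_gt 0 c with hc | hc
    · have : 0 ≤ (l : ℤ) * c := by positivity
      linarith
    · have hl' : (l : ℤ) + 1 ≤ n := by
        rcases hl with hl | hl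
        · exact_mod_cast hl
        · omega
      nlinarith
  exact_mod_cast this

lemma sampleProb_pos {c : ℤ} {n : ℕ} {α : 𝒳 → ℕ} (h : Meaningful c n α)
    (hα : ∀ i, 0 < α i) [Nonempty 𝒳] (x : Fin n → 𝒳) : 0 < sampleProb c α x := by
  unfold sampleProb
  refine div_pos (Finset.prod_pos fun i _ => Finset.prod_pos fun l hl => ?_)
    (Finset.prod_pos fun l hl => ?_)
  · have := h.one_le (hα i) (l := l)
      (Or.inl ((Finset.mem_range.1 hl).trans_le (count_le x i)))
    linarith
  · obtain ⟨i⟩ := ‹Nonempty 𝒳›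
    have := h.one_le (hα i) (l := l) (Or.inl (Finset.mem_range.1 hl))
    have h2 : (α i : ℝ) ≤ ∑ j, (α j : ℝ) :=
      Finset.single_le_sum (f := fun j => (α j : ℝ)) (fun j _ => by positivity)
        (Finset.mem_univ i)
    linarith

lemma pos_of_mem_configs {Φ : Set (stdSimplex ℝ 𝒳)} (hΦ : Φ ⊆ fullSupport 𝒳) {N : ℕ}
    {α : 𝒳 → ℕ} (h : α ∈ configs Φ N) (i : 𝒳) : 0 < α i := by
  obtain ⟨-, q, hq, hqα⟩ := mem_configs.1 h
  have := hΦ hq i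
  rw [hqα] at this
  rcases Nat.eq_zero_or_pos (α i) with h0 | h0
  · simp [h0] at this
  · exact h0

/-! ### The exponential rate of the likelihood -/

/-- The exponential rate of the likelihood of the proportions `q`, up to an additive constant,
if the frequencies in the sample tend to `p`. -/
noncomputable def rate (β : ℝ) (c : ℤ) (p q : stdSimplex ℝ 𝒳) : ℝ :=
  if c = 0 then ∑ i, (p : 𝒳 → ℝ) i * Real.log ((q : 𝒳 → ℝ) i)
  else β⁻¹ / c * ∑ i, (logPrim ((q : 𝒳 → ℝ) i + c * (β * (p : 𝒳 → ℝ) i)) -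
    logPrim ((q : 𝒳 → ℝ) i))

/-- `1 / n` times the logarithm of the numerator of `sampleProb`, relative to `N ^ n`. -/
noncomputable def logLik (c : ℤ) (N n : ℕ) (k α : 𝒳 → ℕ) : ℝ :=
  (∑ i, ∑ l ∈ Finset.range (k i), Real.log ((α i : ℝ) + l * c)) / n - Real.log N

lemma polyaL_eq {β : ℝ} (hβ : β ≠ 0) (c : ℤ) {q p : stdSimplex ℝ 𝒳} (hq : q ∈ fullSupport 𝒳)
    (hqp : ∀ i, 0 < (q : 𝒳 → ℝ) i + β * c * (p : 𝒳 → ℝ) i) :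
    polyaL β c q p = -rate β c p q - 1 := by
  unfold polyaL rate
  split_ifs with hc
  · ring
  · have hc' : (c : ℝ) ≠ 0 := by exact_mod_cast hc
    have hp : ∑ i, (p : 𝒳 → ℝ) i = 1 := p.2.2
    have key : ∀ i, logPrim ((q : 𝒳 → ℝ) i + c * (β * (p : 𝒳 → ℝ) i)) - logPrim ((q : 𝒳 → ℝ) i)
        = β * c * ((p : 𝒳 → ℝ) i * Real.log ((q : 𝒳 → ℝ) i + β * c * (p : 𝒳 → ℝ) i)) -
          (q : 𝒳 → ℝ) i * Real.log ((q : 𝒳 → ℝ) i / ((q : 𝒳 → ℝ) i + β * c * (p : 𝒳 → ℝ) i))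
          - β * c * (p : 𝒳 → ℝ) i := by
      intro i
      have e : (q : 𝒳 → ℝ) i + c * (β * (p : 𝒳 → ℝ) i) =
        (q : 𝒳 → ℝ) i + β * c * (p : 𝒳 → ℝ) i := by ring
      rw [e, Real.log_div (hq i).ne' (hqp i).ne']
      unfold logPrim
      ring
    simp only [key, Finset.sum_sub_distrib, ← Finset.mul_sum, hp]
    field_simp
    ring_nf

/-- The second factor depends on `α` only through `N`, hence cancels in the posterior. -/
lemma log_sampleProb {c : ℤ} {n : ℕ} {α : 𝒳 → ℕ} (h : Meaningful c n α)
    (hα : ∀ i, 0 < α i) [Nonempty 𝒳] (hn : n ≠ 0) {N : ℕ} (hN : ∑ i, α i = N) (x : Fin n → 𝒳) :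
    sampleProb c α x = Real.exp (n * logLik c N n (count x) α) *
      (Real.exp (n * Real.log N) / ∏ l ∈ Finset.range n, ((N : ℝ) + l * c)) := by
  unfold sampleProb logLik
  have hn' : (n : ℝ) ≠ 0 := by exact_mod_cast hn
  have e : (∑ i, (α i : ℝ)) = N := by exact_mod_cast hN
  rw [e, mul_div_assoc', ← Real.exp_add]
  congr 1
  rw [mul_sub, mul_div_cancel₀ _ hn', sub_add_cancel, Real.exp_sum]
  refine Finset.prod_congr rfl fun i _ => ?_
  rw [Real.exp_sum]
  refine Finset.prod_congr rfl fun l hl => ?_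
  rw [Real.exp_log]
  have := h.one_le (hα i) (l := l)
    (Or.inl ((Finset.mem_range.1 hl).trans_le (count_le x i)))
  linarith

lemma tendsto_log_div_self {y : ℕ → ℝ} {b : ℝ} (hb : 0 < b)
    (hy : Tendsto (fun n => y n / (n : ℝ)) atTop (𝓝 b)) :
    Tendsto (fun n => Real.log (y n) / (n : ℝ)) atTop (𝓝 0) := by
  have hy' : Tendsto y atTop atTop := by
    have h1 := hy.pos_mul_atTop hb tendsto_natCast_atTop_atTop
    refine h1.congr' ?_
    filter_upwards [eventually_ne_atTop 0] with n hn
    have : (n : ℝ) ≠ 0 := by exact_mod_cast hn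
    field_simp
  have h2 := (Real.isLittleO_log_id_atTop.tendsto_div_nhds_zero.comp hy').mul hy
  rw [zero_mul] at h2
  refine h2.congr' ?_
  filter_upwards [hy'.eventually_gt_atTop 0] with n hn
  simp only [Function.comp, id]
  field_simp

/-- Uniform convergence of the normalised log-likelihood, `c ≠ 0`. -/
lemma logLik_uniform_of_ne {β : ℝ} {c : ℤ} (hc : c ≠ 0) (hβ : 0 < β)
    {N : ℕ → ℕ} (hN : Tendsto (fun n : ℕ => (n : ℝ) / (N n : ℝ)) atTop (𝓝 β))
    {Φ : Set (stdSimplex ℝ 𝒳)} (hΦ : Φ ⊆ fullSupport 𝒳)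
    (hmΦ : ∀ᶠ n in atTop, ∀ α ∈ configs Φ (N n), Meaningful c n α)
    {r : stdSimplex ℝ 𝒳} (hr : ∀ i, (r : 𝒳 → ℝ) i < 1 ∨ 0 ≤ c)
    {k : ℕ → 𝒳 → ℕ} (hk : ∀ n, ∑ i, k n i = n)
    (hkr : ∀ i, Tendsto (fun n => (k n i : ℝ) / n) atTop (𝓝 ((r : 𝒳 → ℝ) i)))
    {ε : ℝ} (hε : 0 < ε) :
    ∀ᶠ n in atTop, ∀ α ∈ configs Φ (N n), ∀ q : stdSimplex ℝ 𝒳,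
      (∀ i, (q : 𝒳 → ℝ) i = (α i : ℝ) / N n) →
      |logLik c (N n) n (k n) α - rate β c r q| ≤ ε := by
  have hc' : (c : ℝ) ≠ 0 := by exact_mod_cast hc
  -- joint continuity of the limiting expression, uniformly over the compact simplex
  let f : (ℝ × (𝒳 → ℝ)) → stdSimplex ℝ 𝒳 → ℝ := fun w q =>
    w.1 / c * ∑ i, (logPrim ((q : 𝒳 → ℝ) i + c * w.2 i) - logPrim ((q : 𝒳 → ℝ) i))
  have hfc : Continuous (Function.uncurry f) := by
    have hco : ∀ i, Continuous fun z : (ℝ × (𝒳 → ℝ)) × stdSimplex ℝ 𝒳 => (z.2 : 𝒳 → ℝ) i :=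
      fun i => (continuous_apply i).comp (continuous_subtype_val.comp continuous_snd)
    have hcw : ∀ i, Continuous fun z : (ℝ × (𝒳 → ℝ)) × stdSimplex ℝ 𝒳 => z.1.2 i :=
      fun i => (continuous_apply i).comp (continuous_snd.comp continuous_fst)
    refine ((continuous_fst.comp continuous_fst).div_const _).mul
      (continuous_finsetSum _ fun i _ => ?_)
    exact (continuous_logPrim.comp ((hco i).add (continuous_const.mul (hcw i)))).sub
      (continuous_logPrim.comp (hco i))
  obtain ⟨v, hv, hvf⟩ := (isCompact_univ (X := stdSimplex ℝ 𝒳)).mem_uniformity_of_prod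
    (f := f) (s := Set.univ) (q := (β⁻¹, fun i => β * (r : 𝒳 → ℝ) i)) hfc.continuousOn (Set.mem_univ _) (Metric.dist_mem_uniformity (half_pos hε))
  rw [nhdsWithin_univ] at hv
  have hlim : Tendsto (fun n : ℕ => (((n : ℝ) / N n)⁻¹, fun i => (n : ℝ) / N n * ((k n i : ℝ) / n)))
      atTop (𝓝 ((β⁻¹, fun i => β * (r : 𝒳 → ℝ) i) : ℝ × (𝒳 → ℝ))) :=
    (hN.inv₀ hβ.ne').prodMk_nhds (tendsto_pi_nhds.2 fun i => hN.mul (hkr i))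
  have hlog : Tendsto (fun n : ℕ => Fintype.card 𝒳 *
      (Real.log ((N n : ℝ) + n * |(c : ℝ)|) / (n : ℝ))) atTop (𝓝 (Fintype.card 𝒳 * 0)) := by
    refine (tendsto_log_div_self (b := β⁻¹ + |(c : ℝ)|) (by positivity) ?_).const_mul _
    refine ((hN.inv₀ hβ.ne').add_const |(c : ℝ)|).congr' ?_
    filter_upwards [eventually_ne_atTop 0] with n hn
    have : (n : ℝ) ≠ 0 := by exact_mod_cast hn
    rw [inv_div]
    field_simp
  rw [mul_zero] at hlog
  -- For `c < 0` the sum bounds also use the endpoint `l = k n i`, which is safe only if it is below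
  -- `n`; `r i < 1` ensures this eventually.
  have hkn : ∀ᶠ n in atTop, ∀ i, k n i < n ∨ 0 ≤ c := by
    rw [eventually_all]
    intro i
    rcases hr i with h | h
    · filter_upwards [(hkr i).eventually_lt_const h, eventually_gt_atTop 0] with n h1 hn
      left
      have : (0 : ℝ) < n := by exact_mod_cast hn
      rw [div_lt_one this] at h1
      exact_mod_cast h1
    · exact Eventually.of_forall fun _ => Or.inr h
  filter_upwards [hlim hv, hlog.eventually_lt_const (half_pos hε), hkn, hmΦ,
    hN.eventually_const_lt hβ, eventually_gt_atTop 0] with n hvn hlogn hkn hm hNpos hn α hα q hq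
  have hn' : (0 : ℝ) < n := by exact_mod_cast hn
  have hN' : (0 : ℝ) < N n := by
    rcases Nat.eq_zero_or_pos (N n) with h | h
    · simp [h] at hNpos
    · exact_mod_cast h
  have h1 := hvf _ hvn q (Set.mem_univ q)
  simp only [Set.mem_ofPred_eq, Real.dist_eq] at h1
  have hrate : rate β c r q = f (β⁻¹, fun i => β * (r : 𝒳 → ℝ) i) q := by
    simp [rate, hc, f]
  have hsumα : ∑ i, α i = N n := (mem_configs.1 hα).1
  have hpos : ∀ i l, l ≤ k n i → (1 : ℝ) ≤ (α i : ℝ) + l * c := fun i l hl =>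
    (hm α hα).one_le (pos_of_mem_configs hΦ hα i) ((hkn i).imp_left fun h => hl.trans_lt h)
  -- Both endpoint logarithms lie between 0 and `log (N + n |c|)`, hence so does the absolute value
  -- of their difference.
  have hb : ∀ i, |logPrim ((α i : ℝ) + k n i * c) - logPrim (α i) -
      c * ∑ l ∈ Finset.range (k n i), Real.log ((α i : ℝ) + l * c)| ≤
      |(c : ℝ)| * Real.log ((N n : ℝ) + n * |(c : ℝ)|) := by
    intro i
    obtain ⟨h2, h3⟩ := sum_log_bounds (a := α i) (c := c) (m := k n i)
      fun l hl => zero_lt_one.trans_le (hpos i l hl)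
    rw [abs_of_nonneg h2]
    refine h3.trans ((le_abs_self _).trans ?_)
    rw [abs_mul]
    refine mul_le_mul_of_nonneg_left ?_ (abs_nonneg _)
    have ha1 : (1 : ℝ) ≤ α i := by simpa using hpos i 0 (Nat.zero_le _)
    have ha2 := hpos i (k n i) le_rfl
    have hαN : (α i : ℝ) ≤ N n := by
      have : α i ≤ N n := hsumα ▸ Finset.single_le_sum (fun j _ => Nat.zero_le _)
        (Finset.mem_univ i)
      exact_mod_cast this
    have hkn' : (k n i : ℝ) ≤ n := by
      have : k n i ≤ n := (Finset.single_le_sum (f := k n) (fun j _ => Nat.zero_le _)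
        (Finset.mem_univ i)).trans_eq (hk n)
      exact_mod_cast this
    have hkc : (k n i : ℝ) * c ≤ n * |(c : ℝ)| :=
      (mul_le_mul_of_nonneg_left (le_abs_self _) (by positivity)).trans
        (mul_le_mul_of_nonneg_right hkn' (abs_nonneg _))
    have hnc : 0 ≤ (n : ℝ) * |(c : ℝ)| := by positivity
    have l1 := Real.log_nonneg ha1
    have l2 := Real.log_nonneg ha2
    have l3 := Real.log_le_log (by linarith) (show (α i : ℝ) ≤ N n + n * |(c : ℝ)| by linarith)
    have l4 := Real.log_le_log (by linarith)
      (show (α i : ℝ) + k n i * c ≤ N n + n * |(c : ℝ)| by linarith)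
    rw [abs_le]
    constructor <;> linarith
  have hsum := (Finset.abs_sum_le_sum_abs _ _).trans (Finset.sum_le_sum fun i
    (_ : i ∈ Finset.univ) => hb i)
  rw [Finset.sum_const, Finset.card_univ, nsmul_eq_mul, Finset.sum_sub_distrib,
    ← Finset.mul_sum] at hsum
  -- Rescaling by `N` produces the extra term `c * n * log N`, which is what the `- log N` in
  -- `logLik` compensates.
  have hscale : ∑ i, (logPrim ((α i : ℝ) + k n i * c) - logPrim (α i)) =
      N n * ∑ i, (logPrim ((q : 𝒳 → ℝ) i + c * ((n : ℝ) / N n * ((k n i : ℝ) / n))) -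
        logPrim ((q : 𝒳 → ℝ) i)) + c * n * Real.log (N n) := by
    have hkn' : (∑ i, (k n i : ℝ)) = n := by exact_mod_cast hk n
    have : (c : ℝ) * n * Real.log (N n) = ∑ i, c * k n i * Real.log (N n) := by
      rw [← hkn', Finset.mul_sum, Finset.sum_mul]
    rw [this, Finset.mul_sum, ← Finset.sum_add_distrib]
    refine Finset.sum_congr rfl fun i _ => ?_
    have e1 : (α i : ℝ) = N n * (q : 𝒳 → ℝ) i := by rw [hq]; field_simp
    have e2 : (α i : ℝ) + k n i * c =
        N n * ((q : 𝒳 → ℝ) i + c * ((n : ℝ) / N n * ((k n i : ℝ) / n))) := by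
      rw [hq]; field_simp
    rw [e2, e1, logPrim_mul hN', logPrim_mul hN']
    field_simp
    ring
  rw [hscale] at hsum
  have hmain : |logLik c (N n) n (k n) α -
      f (((n : ℝ) / N n)⁻¹, fun i => (n : ℝ) / N n * ((k n i : ℝ) / n)) q| ≤
      Fintype.card 𝒳 * (Real.log ((N n : ℝ) + n * |(c : ℝ)|) / (n : ℝ)) := by
    have hcn : 0 < |(c : ℝ)| * n := by positivity
    refine le_of_mul_le_mul_left ?_ hcn
    calc |(c : ℝ)| * n * _ = |-((c : ℝ) * n * (logLik c (N n) n (k n) α -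
          f (((n : ℝ) / N n)⁻¹, fun i => (n : ℝ) / N n * ((k n i : ℝ) / n)) q))| := by
          rw [abs_neg, abs_mul, abs_mul, abs_of_pos hn']
      _ ≤ Fintype.card 𝒳 * (|(c : ℝ)| * Real.log ((N n : ℝ) + n * |(c : ℝ)|)) := by
          refine le_of_eq_of_le (congrArg _ ?_) hsum
          simp only [logLik, f, inv_div]
          field_simp
          ring
      _ = _ := by field_simp
  rw [hrate]
  rw [abs_le] at hmain ⊢
  rw [abs_lt] at h1
  constructor <;> linarith [h1.1, h1.2, hmain.1, hmain.2]

/-- For `c = 0` the rate may be unbounded near the boundary of the simplex, so only the relative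
error is uniformly small. All terms `r i * log (q i)` have the same sign, so relative errors of the
frequencies pass to the sum. -/
lemma logLik_uniform_zero {β : ℝ} {N : ℕ → ℕ} (hN0 : ∀ᶠ n in atTop, 0 < N n)
    {Φ : Set (stdSimplex ℝ 𝒳)} (hΦ : Φ ⊆ fullSupport 𝒳)
    {r : stdSimplex ℝ 𝒳} (hr : r ∈ fullSupport 𝒳)
    {k : ℕ → 𝒳 → ℕ} (hk : ∀ n, ∑ i, k n i = n)
    (hkr : ∀ i, Tendsto (fun n => (k n i : ℝ) / n) atTop (𝓝 ((r : 𝒳 → ℝ) i)))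
    {ε : ℝ} (hε : 0 < ε) :
    ∀ᶠ n in atTop, ∀ α ∈ configs Φ (N n), ∀ q : stdSimplex ℝ 𝒳,
      (∀ i, (q : 𝒳 → ℝ) i = (α i : ℝ) / N n) →
      |logLik 0 (N n) n (k n) α - rate β 0 r q| ≤ ε * |rate β 0 r q| := by
  have hev : ∀ᶠ n in atTop, ∀ i, |(k n i : ℝ) / n - (r : 𝒳 → ℝ) i| < ε * (r : 𝒳 → ℝ) i := by
    rw [eventually_all]
    intro i
    simpa [Real.dist_eq] using Metric.tendsto_nhds.1 (hkr i) _ (mul_pos hε (hr i))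
  filter_upwards [hev, hN0, eventually_gt_atTop 0] with n h hN0 hn α hα q hq
  have hn' : (0 : ℝ) < n := by exact_mod_cast hn
  have hN' : (0 : ℝ) < N n := by exact_mod_cast hN0
  have hlog : ∀ i, Real.log ((q : 𝒳 → ℝ) i) ≤ 0 := fun i =>
    Real.log_nonpos (q.2.1 i) (by
      have := Finset.single_le_sum (f := (q : 𝒳 → ℝ)) (fun j _ => q.2.1 j) (Finset.mem_univ i)
      exact this.trans_eq q.2.2)
  have e : logLik 0 (N n) n (k n) α = ∑ i, (k n i : ℝ) / n * Real.log ((q : 𝒳 → ℝ) i) := by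
    have hkn' : (∑ i, (k n i : ℝ)) = n := by exact_mod_cast hk n
    have hl : ∀ i, Real.log ((q : 𝒳 → ℝ) i) = Real.log (α i) - Real.log (N n) := fun i => by
      have := pos_of_mem_configs hΦ hα i
      rw [hq, Real.log_div (by positivity) hN'.ne']
    simp only [logLik, hl, mul_sub, Finset.sum_sub_distrib, ← Finset.sum_mul,
      ← Finset.sum_div, hkn', div_self hn'.ne']
    simp [Finset.sum_div, div_mul_eq_mul_div]
  rw [e, rate, if_pos rfl, ← Finset.sum_sub_distrib]
  calc _ ≤ ∑ i, |(k n i : ℝ) / n * Real.log ((q : 𝒳 → ℝ) i) -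
        (r : 𝒳 → ℝ) i * Real.log ((q : 𝒳 → ℝ) i)| := Finset.abs_sum_le_sum_abs _ _
    _ ≤ ∑ i, ε * -((r : 𝒳 → ℝ) i * Real.log ((q : 𝒳 → ℝ) i)) := by
        refine Finset.sum_le_sum fun i _ => ?_
        rw [← sub_mul, abs_mul, abs_of_nonpos (hlog i)]
        have := mul_le_mul_of_nonneg_right (h i).le (neg_nonneg.2 (hlog i))
        linarith
    _ = ε * |∑ i, (r : 𝒳 → ℝ) i * Real.log ((q : 𝒳 → ℝ) i)| := by
        rw [← Finset.mul_sum, Finset.sum_neg_distrib, abs_of_nonpos]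
        exact Finset.sum_nonpos fun i _ => mul_nonpos_of_nonneg_of_nonpos (hr i).le (hlog i)

lemma continuousOn_rate (β : ℝ) (c : ℤ) (r : stdSimplex ℝ 𝒳) :
    ContinuousOn (rate β c r) (fullSupport 𝒳) := by
  have hco : ∀ i, Continuous fun z : stdSimplex ℝ 𝒳 => (z : 𝒳 → ℝ) i :=
    fun i => (continuous_apply i).comp continuous_subtype_val
  unfold rate
  split_ifs with hc
  · exact continuousOn_finsetSum _ fun i _ => continuousOn_const.mul
      ((hco i).continuousOn.log fun q hq => (hq i).ne')
  · exact (continuous_const.mul (continuous_finsetSum _ fun i _ =>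
      (continuous_logPrim.comp ((hco i).add continuous_const)).sub
        (continuous_logPrim.comp (hco i)))).continuousOn

lemma bddAbove_rate (β : ℝ) (c : ℤ) {r : stdSimplex ℝ 𝒳} (hr : r ∈ fullSupport 𝒳) :
    BddAbove (Set.range (rate β c r)) := by
  have hco : ∀ i, Continuous fun z : stdSimplex ℝ 𝒳 => (z : 𝒳 → ℝ) i :=
    fun i => (continuous_apply i).comp continuous_subtype_val
  by_cases hc : c = 0
  · refine ⟨0, ?_⟩
    rintro _ ⟨q, rfl⟩
    rw [rate, if_pos hc]
    refine Finset.sum_nonpos fun i _ => mul_nonpos_of_nonneg_of_nonpos (hr i).le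
      (Real.log_nonpos (q.2.1 i) ?_)
    have := Finset.single_le_sum (f := (q : 𝒳 → ℝ)) (fun j _ => q.2.1 j) (Finset.mem_univ i)
    exact this.trans_eq q.2.2
  · have : Continuous (rate β c r) := by
      unfold rate
      simp only [if_neg hc]
      exact continuous_const.mul (continuous_finsetSum _ fun i _ =>
        (continuous_logPrim.comp ((hco i).add continuous_const)).sub
        (continuous_logPrim.comp (hco i)))
    exact (isCompact_range this).bddAbove

/-! ### Laplace's principle for sums weighted by the prior -/

/-- Upper bound: `F ≤ s` on `A` and the prior has total mass at most 1. Lower bound: the part of `A`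
where `F > s - ε` is open and nonempty, so its prior mass is at least `exp (-ε n)`. The error `ε *
(1 + |F q|)` accommodates both the absolute and the relative estimate of the likelihood. -/
lemma tendsto_log_sum_configs {Φ A : Set (stdSimplex ℝ 𝒳)} (hAΦ : A ⊆ Φ)
    (hAo : IsOpen A) {N : ℕ → ℕ} {π : ℕ → PMF (𝒳 → ℕ)}
    (hπ' : ∀ G ⊆ Φ, IsOpen G → G.Nonempty → ∀ ε : ℝ, 0 < ε →
      ∀ᶠ n : ℕ in atTop, Real.exp (-(ε * n)) ≤ priorMass (π n) (N n) G)
    {F : stdSimplex ℝ 𝒳 → ℝ} (hFc : ContinuousOn F Φ) {s : ℝ} (hs : IsLUB (F '' A) s)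
    {f : ℕ → (𝒳 → ℕ) → ℝ}
    (hf : ∀ ε : ℝ, 0 < ε → ∀ᶠ n in atTop, ∀ α ∈ configs Φ (N n), ∀ q : stdSimplex ℝ 𝒳,
      (∀ i, (q : 𝒳 → ℝ) i = (α i : ℝ) / N n) → |f n α - F q| ≤ ε * (1 + |F q|)) :
    (∀ᶠ n in atTop, 0 < ∑ α ∈ configs A (N n), (π n α).toReal * Real.exp (n * f n α)) ∧
    Tendsto (fun n : ℕ => 1 / (n : ℝ) *
      Real.log (∑ α ∈ configs A (N n), (π n α).toReal * Real.exp (n * f n α))) atTop (𝓝 s) := by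
  have hmono : ∀ {B C : Set (stdSimplex ℝ 𝒳)}, B ⊆ C → ∀ n, configs B n ⊆ configs C n := by
    intro B C h n α hα
    obtain ⟨h1, q, hq, h2⟩ := mem_configs.1 hα
    exact mem_configs.2 ⟨h1, q, h hq, h2⟩
  have key : ∀ ε : ℝ, 0 < ε → ε < 1 → ∀ᶠ n : ℕ in atTop,
      Real.exp (n * (s - ε - ε * (1 + |s - ε|) - ε)) ≤
        ∑ α ∈ configs A (N n), (π n α).toReal * Real.exp (n * f n α) ∧
      ∑ α ∈ configs A (N n), (π n α).toReal * Real.exp (n * f n α) ≤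
        Real.exp (n * (s + ε * (1 + |s|))) := by
    intro ε hε hε1
    let G := A ∩ F ⁻¹' Set.Ioi (s - ε)
    have hGo : IsOpen G := (hFc.mono hAΦ).isOpen_inter_preimage hAo isOpen_Ioi
    have hG : G.Nonempty := by
      obtain ⟨_, ⟨q, hq, rfl⟩, h⟩ := (lt_isLUB_iff hs).1 (show s - ε < s by linarith)
      exact ⟨q, hq, h⟩
    filter_upwards [hf ε hε, hπ' G (fun q hq => hAΦ hq.1) hGo hG ε hε] with n h1 h2
    -- Since `ε < 1`, both `a + ε * (1 + |a|)` and `a - ε * (1 + |a|)` increase with `a`, so bounds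
    -- on `F q` carry over to bounds with the error included.
    have hmonoφ : ∀ a b : ℝ, a ≤ b → a + ε * (1 + |a|) ≤ b + ε * (1 + |b|) ∧
        a - ε * (1 + |a|) ≤ b - ε * (1 + |b|) := by
      intro a b hab
      have h := abs_abs_sub_abs_le a b
      rw [abs_of_nonpos (sub_nonpos.2 hab), abs_le] at h
      constructor <;> nlinarith [h.1, h.2]
    constructor
    · calc Real.exp (n * (s - ε - ε * (1 + |s - ε|) - ε))
          = Real.exp (-(ε * n)) * Real.exp (n * (s - ε - ε * (1 + |s - ε|))) := by
            rw [← Real.exp_add]; ring_nf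
        _ ≤ priorMass (π n) (N n) G * Real.exp (n * (s - ε - ε * (1 + |s - ε|))) := by gcongr
        _ = ∑ α ∈ configs G (N n), (π n α).toReal *
              Real.exp (n * (s - ε - ε * (1 + |s - ε|))) := by
            rw [priorMass, Finset.sum_mul]
        _ ≤ ∑ α ∈ configs G (N n), (π n α).toReal * Real.exp (n * f n α) := by
            refine Finset.sum_le_sum fun α hα => ?_
            obtain ⟨-, q, hq, hqα⟩ := mem_configs.1 hα
            have h3 := h1 α (hmono (fun q hq => hAΦ hq.1) _ hα) q hqα
            have h4 := (hmonoφ _ _ (le_of_lt hq.2)).2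
            rw [abs_le] at h3
            gcongr
            linarith [h3.1]
        _ ≤ _ := Finset.sum_le_sum_of_subset_of_nonneg (hmono Set.inter_subset_left _)
            fun _ _ _ => by positivity
    · calc _ ≤ ∑ α ∈ configs A (N n), (π n α).toReal * Real.exp (n * (s + ε * (1 + |s|))) := by
            refine Finset.sum_le_sum fun α hα => ?_
            obtain ⟨-, q, hq, hqα⟩ := mem_configs.1 hα
            have h3 := h1 α (hmono hAΦ _ hα) q hqα
            have h4 := (hmonoφ _ _ (hs.1 ⟨q, hq, rfl⟩)).1
            rw [abs_le] at h3
            gcongr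
            linarith [h3.2]
        _ ≤ 1 * Real.exp (n * (s + ε * (1 + |s|))) := by
            rw [← Finset.sum_mul]
            gcongr
            rw [← ENNReal.toReal_sum fun α _ => (π n).apply_ne_top α]
            refine ENNReal.toReal_le_of_le_ofReal zero_le_one ?_
            rw [ENNReal.ofReal_one, ← (π n).tsum_coe]
            exact ENNReal.sum_le_tsum _
        _ = _ := one_mul _
  refine ⟨?_, ?_⟩
  · filter_upwards [key (1 / 2) (by norm_num) (by norm_num)] with n hn
    exact (Real.exp_pos _).trans_le hn.1
  · rw [Metric.tendsto_nhds]
    intro δ hδ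
    -- This is the sum of the slacks of the two bounds in `key`.
    have hlim : Tendsto (fun ε : ℝ => ε + ε * (1 + |s - ε|) + ε + ε * (1 + |s|)) (𝓝[>] 0)
        (𝓝 0) := by
      have : Continuous fun ε : ℝ => ε + ε * (1 + |s - ε|) + ε + ε * (1 + |s|) := by fun_prop
      simpa using (this.tendsto 0).mono_left nhdsWithin_le_nhds
    obtain ⟨ε, hεδ, hε, hε1⟩ := ((hlim.eventually_lt_const hδ).and
      (Ioo_mem_nhdsGT (zero_lt_one (α := ℝ)))).exists
    filter_upwards [key ε hε hε1, eventually_gt_atTop 0] with n ⟨h1, h2⟩ hn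
    have hn' : (0 : ℝ) < n := by exact_mod_cast hn
    have l1 := Real.log_le_log (Real.exp_pos _) h1
    have l2 := Real.log_le_log ((Real.exp_pos _).trans_le h1) h2
    rw [Real.log_exp] at l1 l2
    rw [← le_div_iff₀' hn'] at l1
    rw [← div_le_iff₀' hn'] at l2
    rw [Real.dist_eq, one_div_mul_eq_div, abs_lt]
    have p1 : 0 ≤ ε * (1 + |s - ε|) := by positivity
    have p2 : 0 ≤ ε * (1 + |s|) := by positivity
    constructor <;> linarith

/-! ### Exponential moments of the Pólya urn -/

lemma sum_fin_succ_fun {m : ℕ} (g : (Fin (m + 1) → 𝒳) → ℝ) :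
    ∑ x, g x = ∑ x : Fin m → 𝒳, ∑ j, g (Fin.snoc x j) := by
  rw [← (Fin.snocEquiv fun _ : Fin (m + 1) => 𝒳).sum_comp, Fintype.sum_prod_type_right]
  rfl

lemma count_snoc {m : ℕ} (x : Fin m → 𝒳) (j i : 𝒳) :
    count (Fin.snoc x j : Fin (m + 1) → 𝒳) i = count x i + if j = i then 1 else 0 := by
  simp only [count, Finset.card_filter, Fin.sum_univ_castSucc, Fin.snoc_castSucc, Fin.snoc_last]

/-- The new factor is the conditional probability of drawing `j` after `x`. -/
lemma sampleProb_snoc (c : ℤ) (α : 𝒳 → ℕ) {m : ℕ} (x : Fin m → 𝒳) (j : 𝒳) :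
    sampleProb c α (Fin.snoc x j : Fin (m + 1) → 𝒳) =
      sampleProb c α x * (((α j : ℝ) + count x j * c) / ((∑ i, (α i : ℝ)) + m * c)) := by
  unfold sampleProb
  rw [Finset.prod_range_succ, div_mul_div_comm]
  congr 1
  rw [← Finset.mul_prod_erase Finset.univ (fun i : 𝒳 => ∏ l ∈ Finset.range
      (count (Fin.snoc x j : Fin (m + 1) → 𝒳) i), ((α i : ℝ) + l * c)) (Finset.mem_univ j),
    ← Finset.mul_prod_erase Finset.univ (fun i : 𝒳 => ∏ l ∈ Finset.range (count x i),
      ((α i : ℝ) + l * c)) (Finset.mem_univ j),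
    count_snoc, if_pos rfl, Finset.prod_range_succ, mul_right_comm]
  congr 2
  refine Finset.prod_congr rfl fun i hi => ?_
  rw [count_snoc, if_neg (Finset.ne_of_mem_erase hi).symm, add_zero]

lemma sampleProb_nonneg {c : ℤ} {n : ℕ} {α : 𝒳 → ℕ} (h : Meaningful c n α)
    (hN : ∀ l : ℕ, l < n → 0 ≤ (∑ i, (α i : ℝ)) + l * c) {m : ℕ} (hm : m ≤ n) (x : Fin m → 𝒳) :
    0 ≤ sampleProb c α x := by
  unfold sampleProb
  refine div_nonneg (Finset.prod_nonneg fun i _ => Finset.prod_nonneg fun l hl => ?_)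
    (Finset.prod_nonneg fun l hl => hN l ((Finset.mem_range.1 hl).trans_le hm))
  exact h.nonneg (((Finset.mem_range.1 hl).trans_le (count_le x i)).le.trans hm) i

/-- A bound for the exponential moments of a centred indicator. -/
lemma sum_mul_exp_indicator_le {p : 𝒳 → ℝ} (hp : ∀ j, 0 ≤ p j) (hp1 : ∑ j, p j = 1) (i : 𝒳)
    {s : ℝ} (hs : |s| ≤ 1) :
    ∑ j, p j * Real.exp (s * ((if j = i then 1 else 0) - p i)) ≤ Real.exp (s ^ 2) := by
  have hpi : p i ≤ 1 := hp1 ▸ Finset.single_le_sum (fun j _ => hp j) (Finset.mem_univ i)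
  -- Uses `exp u ≤ 1 + u + u ^ 2` for `|u| ≤ 1`; the linear term has mean zero.
  calc _ ≤ ∑ j, p j * (1 + s * ((if j = i then 1 else 0) - p i) + s ^ 2) := by
        refine Finset.sum_le_sum fun j _ => mul_le_mul_of_nonneg_left ?_ (hp j)
        have hd : |(if j = i then (1 : ℝ) else 0) - p i| ≤ 1 := by
          have := hp i
          rw [abs_le]
          split_ifs <;> constructor <;> linarith
        have h1 : |s * ((if j = i then (1 : ℝ) else 0) - p i)| ≤ 1 := by
          rw [abs_mul]; exact mul_le_one₀ hs (abs_nonneg _) hd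
        have h2 := (abs_le.1 (Real.abs_exp_sub_one_sub_id_le h1)).2
        have h3 : (s * ((if j = i then (1 : ℝ) else 0) - p i)) ^ 2 ≤ s ^ 2 := by
          rw [mul_pow]
          exact mul_le_of_le_one_right (sq_nonneg _) ((sq_le_one_iff_abs_le_one _).2 hd)
        linarith
    _ = s ^ 2 + 1 := by
        have : ∀ j, p j * (1 + s * ((if j = i then 1 else 0) - p i) + s ^ 2) =
            p j * (1 - s * p i + s ^ 2) + if j = i then s * p j else 0 := by
          intro j; split_ifs <;> ring
        simp only [this, Finset.sum_add_distrib, ← Finset.sum_mul, hp1, Finset.sum_ite_eq',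
          Finset.mem_univ, if_true]
        ring
    _ ≤ _ := Real.add_one_le_exp _

/-- The quantity multiplied by `lam` is a martingale: its increment at step `m + 1` is the indicator
of colour `i`, centred at its conditional probability and divided by `N + (m + 1) * c ≥ D`. Each
step therefore multiplies the moment by at most `exp ((lam / D) ^ 2)`. -/
lemma sum_sampleProb_mul_exp_le {c : ℤ} {n : ℕ} {α : 𝒳 → ℕ} (h : Meaningful c n α)
    {N D : ℝ} (hNα : ∑ i, (α i : ℝ) = N) (hD : 0 < D)
    (hND : ∀ l : ℕ, l ≤ n → D ≤ N + l * c) (i : 𝒳) {lam : ℝ} (hlam : |lam| ≤ D)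
    {m : ℕ} (hm : m ≤ n) :
    ∑ x : Fin m → 𝒳, sampleProb c α x *
      Real.exp (lam * (((count x i : ℝ) - m * (α i / N)) / (N + m * c))) ≤
      Real.exp (m * (lam / D) ^ 2) := by
  induction m with
  | zero =>
    have h0 : ∀ x : Fin 0 → 𝒳, ∀ j, count x j = 0 := fun x j => by simp [count]
    simp [sampleProb, h0]
  | succ m ih =>
    have ih := ih (by omega)
    have hN0 := hD.trans_le (hND 0 (Nat.zero_le _))
    have hm0 := hD.trans_le (hND m (by omega))
    have hm1 := hND (m + 1) hm
    have hm1' := hD.trans_le hm1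
    simp only [Nat.cast_zero, zero_mul, add_zero] at hN0
    rw [sum_fin_succ_fun]
    have hsq : (lam / (N + ((m + 1 : ℕ) : ℝ) * c)) ^ 2 ≤ (lam / D) ^ 2 := by
      rw [sq_le_sq, abs_div, abs_div, abs_of_pos hD, abs_of_pos hm1']
      gcongr
    calc _ ≤ ∑ x : Fin m → 𝒳, (sampleProb c α x *
          Real.exp (lam * (((count x i : ℝ) - m * (α i / N)) / (N + m * c)))) *
          Real.exp ((lam / D) ^ 2) := by
          refine Finset.sum_le_sum fun x _ => ?_
          have hcx : (∑ j, (count x j : ℝ)) = m := by exact_mod_cast sum_count x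
          have hp1 : ∑ j, ((α j : ℝ) + count x j * c) / (N + m * c) = 1 := by
            rw [← Finset.sum_div, Finset.sum_add_distrib, ← Finset.sum_mul, hNα, hcx,
              div_self hm0.ne']
          have hb := sum_mul_exp_indicator_le
            (p := fun j => ((α j : ℝ) + count x j * c) / (N + m * c))
            (fun j => div_nonneg (h.nonneg ((count_le x j).trans (by omega)) j) hm0.le) hp1 i
            (s := lam / (N + ((m + 1 : ℕ) : ℝ) * c)) (by
              rw [abs_div, abs_of_pos hm1', div_le_one hm1']
              exact hlam.trans hm1)
          have hx0 : 0 ≤ sampleProb c α x := sampleProb_nonneg h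
            (fun l hl => by rw [hNα]; exact hD.le.trans (hND l hl.le)) (by omega) x
          calc _ = (sampleProb c α x *
                Real.exp (lam * (((count x i : ℝ) - m * (α i / N)) / (N + m * c)))) *
                ∑ j, ((α j : ℝ) + count x j * c) / (N + m * c) *
                  Real.exp (lam / (N + ((m + 1 : ℕ) : ℝ) * c) * ((if j = i then 1 else 0) -
                    ((α i : ℝ) + count x i * c) / (N + m * c))) := by
                rw [Finset.mul_sum]
                refine Finset.sum_congr rfl fun j _ => ?_
                rw [sampleProb_snoc, hNα, count_snoc, mul_mul_mul_comm, ← Real.exp_add,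
                  mul_assoc (sampleProb c α x), mul_assoc (sampleProb c α x)]
                congr 2
                congr 1
                push_cast at hm1' ⊢
                field_simp
                ring
            _ ≤ _ := by
                gcongr
                exact hb.trans (Real.exp_le_exp.2 hsq)
      _ ≤ Real.exp (m * (lam / D) ^ 2) * Real.exp ((lam / D) ^ 2) := by
          rw [← Finset.sum_mul]
          gcongr
      _ = _ := by
          rw [← Real.exp_add]; push_cast; ring_nf

/-! ### The law of large numbers for the sample -/

/-- A one-sided exponential bound for the deviations of the frequency of a colour; the sign `σ`
selects the side. -/
lemma sum_sampleProb_deviation_le {c : ℤ} {n : ℕ} {α : 𝒳 → ℕ} (h : Meaningful c n α)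
    {N K : ℝ} (hNα : ∑ i, (α i : ℝ) = N) (hn : 0 < n)
    (hND : ∀ l : ℕ, l ≤ n → (n : ℝ) ≤ N + l * c) (hK : N + n * c ≤ K * n) (i : 𝒳)
    {σ t ε : ℝ} (hσ : |σ| = 1) (ht0 : 0 < t) (ht1 : t ≤ 1) (htε : 2 * t * K ≤ ε) :
    ∑ x : Fin n → 𝒳 with ε * n ≤ σ * ((count x i : ℝ) - n * (α i / N)), sampleProb c α x ≤
      Real.exp (-(t ^ 2 * n)) := by
  have hn' : (0 : ℝ) < n := by exact_mod_cast hn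
  have hpos := hn'.trans_le (hND n le_rfl)
  have hlam : |t * σ * n| ≤ n := by
    rw [abs_mul, abs_mul, hσ, abs_of_pos ht0, abs_of_pos hn']
    nlinarith
  have hx0 : ∀ x : Fin n → 𝒳, 0 ≤ sampleProb c α x := sampleProb_nonneg h
    (fun l hl => by rw [hNα]; exact hn'.le.trans (hND l hl.le)) le_rfl
  -- Exponential Markov inequality with `lam = t * σ * n` and `D = n`: the moment is at most `exp (t
  -- ^ 2 * n)`, while on the event the exponent is at least `2 * t ^ 2 * n`, by `N + n * c ≤ K * n`
  -- and `2 * t * K ≤ ε`.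
  have hmgf := sum_sampleProb_mul_exp_le h hNα hn' hND i hlam le_rfl
  have e : (n : ℝ) * (t * σ * n / n) ^ 2 = t ^ 2 * n := by
    rw [mul_div_cancel_right₀ _ hn'.ne', mul_pow, ← sq_abs σ, hσ]; ring
  rw [e] at hmgf
  have hle : Real.exp (2 * t ^ 2 * n) *
      ∑ x : Fin n → 𝒳 with ε * n ≤ σ * ((count x i : ℝ) - n * (α i / N)), sampleProb c α x ≤
      Real.exp (t ^ 2 * n) := by
    refine le_trans ?_ hmgf
    rw [Finset.mul_sum]
    refine le_trans (Finset.sum_le_sum fun x hx => ?_)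
      (Finset.sum_le_sum_of_subset_of_nonneg (Finset.filter_subset _ _)
        fun x _ _ => mul_nonneg (hx0 x) (Real.exp_pos _).le)
    rw [mul_comm]
    refine mul_le_mul_of_nonneg_left (Real.exp_le_exp.2 ?_) (hx0 x)
    have hx' := (Finset.mem_filter.1 hx).2
    rw [mul_div_assoc', le_div_iff₀ hpos]
    calc 2 * t ^ 2 * n * (N + n * c) ≤ 2 * t ^ 2 * n * (K * n) := by gcongr
      _ = t * n * ((2 * t * K) * n) := by ring
      _ ≤ t * n * (ε * n) := by gcongr
      _ ≤ t * n * (σ * ((count x i : ℝ) - n * (α i / N))) := by gcongr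
      _ = _ := by ring
  calc _ = Real.exp (-(2 * t ^ 2 * n)) * (Real.exp (2 * t ^ 2 * n) * _) := by
        rw [← mul_assoc, ← Real.exp_add, neg_add_cancel, Real.exp_zero, one_mul]
    _ ≤ Real.exp (-(2 * t ^ 2 * n)) * Real.exp (t ^ 2 * n) := by gcongr
    _ = _ := by rw [← Real.exp_add]; ring_nf

/-- The deviation probabilities are summable, so Borel–Cantelli applies for any coupling of the
samples. Two colours are required for `c < 0` because a single-colour urn may be exhausted by the
sampling. -/
lemma ae_tendsto_count_div [MeasurableSpace 𝒳] [MeasurableSingletonClass 𝒳]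
    {c : ℤ} {β : ℝ} (hβ0 : 0 < β) (hβ1 : β < 1) (hcard : c < 0 → 2 ≤ Fintype.card 𝒳)
    {N : ℕ → ℕ} (hN : Tendsto (fun n : ℕ => (n : ℝ) / (N n : ℝ)) atTop (𝓝 β))
    {r : 𝒳 → ℝ} {rN : ℕ → 𝒳 → ℕ} (hrN : ∀ n, ∑ i, rN n i = N n)
    (hrlim : ∀ i, Tendsto (fun n => (rN n i : ℝ) / (N n : ℝ)) atTop (𝓝 (r i)))
    (hmr : ∀ᶠ n in atTop, Meaningful c n (rN n))
    {Ω : Type*} [MeasurableSpace Ω] (μ : Measure Ω) [IsProbabilityMeasure μ]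
    {X : (n : ℕ) → Ω → Fin n → 𝒳} (hXm : ∀ n, Measurable (X n))
    (hX : ∀ᶠ n in atTop, ∀ x : Fin n → 𝒳, μ.real (X n ⁻¹' {x}) = sampleProb c (rN n) x) :
    ∀ᵐ ω ∂μ, ∀ i, Tendsto (fun n => (count (X n ω) i : ℝ) / n) atTop (𝓝 (r i)) := by
  have hK : ∀ᶠ n : ℕ in atTop, (∀ l : ℕ, l ≤ n → (n : ℝ) ≤ N n + l * c) ∧
      (N n : ℝ) + n * c ≤ (2 / β + |(c : ℝ)|) * n := by
    filter_upwards [hN.eventually_lt_const hβ1, hN.eventually_const_lt (half_lt_self hβ0), hmr]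
      with n h1 h2 h3
    have hN0 : (0 : ℝ) < N n := by
      rcases Nat.eq_zero_or_pos (N n) with h | h
      · simp [h] at h2; linarith
      · exact_mod_cast h
    rw [div_lt_one hN0] at h1
    rw [lt_div_iff₀ hN0] at h2
    refine ⟨fun l hl => ?_, ?_⟩
    · rcases le_or_gt 0 c with hc | hc
      · have : (0 : ℝ) ≤ l * c := mul_nonneg (by positivity) (by exact_mod_cast hc)
        linarith
      -- With two colours, meaningfulness gives `N ≥ 2 * n * |c|`, so at least `n * |c| ≥ n` balls
      -- are left after `l ≤ n` draws.
      · have hs : (2 : ℤ) * (n * -c) ≤ N n := by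
          calc (2 : ℤ) * (n * -c) ≤ Fintype.card 𝒳 * (n * -c) := by
                have := hcard hc
                have h0 : (0 : ℤ) ≤ n * -c := mul_nonneg (by positivity) (by omega)
                gcongr
                exact_mod_cast this
            _ = ∑ _i : 𝒳, (n : ℤ) * -c := by simp
            _ ≤ ∑ i, (rN n i : ℤ) := Finset.sum_le_sum fun i _ => by
                have := h3 i
                linarith
            _ = N n := by exact_mod_cast hrN n
        have hl' : (l : ℤ) ≤ n := by exact_mod_cast hl
        have : (n : ℤ) ≤ N n + l * c := by nlinarith
        exact_mod_cast this
    · have h4 : (n : ℝ) * c ≤ n * |(c : ℝ)| := by gcongr; exact le_abs_self _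
      have h5 : (N n : ℝ) ≤ 2 / β * n := by
        rw [div_mul_eq_mul_div, le_div_iff₀ hβ0]; linarith
      linarith
  have hdev : ∀ i, ∀ ε : ℝ, 0 < ε → ∀ᵐ ω ∂μ, ∀ᶠ n : ℕ in atTop,
      |(count (X n ω) i : ℝ) - n * (rN n i / N n)| < ε * n := by
    intro i ε hε
    set K := 2 / β + |(c : ℝ)| with hKdef
    have hK0 : 0 < K := by positivity
    obtain ⟨t, ht0, ht1, htε⟩ : ∃ t : ℝ, 0 < t ∧ t ≤ 1 ∧ 2 * t * K ≤ ε := by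
      refine ⟨min 1 (ε / (2 * K)), by positivity, min_le_left _ _, ?_⟩
      have := min_le_right 1 (ε / (2 * K))
      rw [le_div_iff₀ (by positivity)] at this
      linarith
    let S : (n : ℕ) → Finset (Fin n → 𝒳) := fun n => Finset.univ.filter
      fun x => ε * n ≤ |(count x i : ℝ) - n * (rN n i / N n)|
    have hS : ∀ᶠ n : ℕ in atTop, μ (X n ⁻¹' (S n : Set (Fin n → 𝒳))) ≤
        ENNReal.ofReal (2 * Real.exp (-(t ^ 2)) ^ n) := by
      filter_upwards [hK, hmr, hX, eventually_gt_atTop 0] with n ⟨h1, h2⟩ h3 h4 hn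
      have hn' : (0 : ℝ) < n := by exact_mod_cast hn
      have hNα : ∑ i, (rN n i : ℝ) = N n := by exact_mod_cast hrN n
      rw [← ofReal_measureReal]
      refine ENNReal.ofReal_le_ofReal ?_
      have e : μ.real (X n ⁻¹' (S n : Set (Fin n → 𝒳))) = ∑ x ∈ S n, sampleProb c (rN n) x := by
        rw [← sum_measureReal_preimage_singleton _
          fun x _ => hXm n (measurableSet_singleton x)]
        exact Finset.sum_congr rfl fun x _ => h4 x
      have hx0 : ∀ x : Fin n → 𝒳, 0 ≤ sampleProb c (rN n) x := fun x =>
        h4 x ▸ measureReal_nonneg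
      have hsub : S n ⊆
          (Finset.univ.filter fun x => ε * n ≤ 1 * ((count x i : ℝ) - n * (rN n i / N n))) ∪
          (Finset.univ.filter
            fun x => ε * n ≤ -1 * ((count x i : ℝ) - n * (rN n i / N n))) := by
        intro x hx
        have hx := (Finset.mem_filter.1 hx).2
        simp only [Finset.mem_union, Finset.mem_filter, Finset.mem_univ, true_and, one_mul,
          neg_mul]
        exact le_abs.1 hx
      have hu := sum_sampleProb_deviation_le h3 hNα hn h1 h2 i (σ := 1) (by simp) ht0 ht1 htε
      have hl := sum_sampleProb_deviation_le h3 hNα hn h1 h2 i (σ := -1) (by simp) ht0 ht1 htε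
      rw [e, ← Real.exp_nat_mul, mul_neg, mul_comm (n : ℝ), two_mul]
      refine (Finset.sum_le_sum_of_subset_of_nonneg hsub fun x _ _ => hx0 x).trans ?_
      refine le_trans ?_ (add_le_add hu hl)
      rw [← Finset.sum_union_inter]
      exact le_add_of_nonneg_right (Finset.sum_nonneg fun x _ => hx0 x)
    obtain ⟨n₀, hn₀⟩ := eventually_atTop.1 hS
    have hsummable : Summable fun n : ℕ => 2 * Real.exp (-(t ^ 2)) ^ n :=
      (summable_geometric_of_lt_one (Real.exp_pos _).le
        (Real.exp_lt_one_iff.2 (by simpa using pow_pos ht0 2))).mul_left 2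
    have hbc := ae_eventually_notMem (μ := μ)
      (s := fun n => X (n + n₀) ⁻¹' (S (n + n₀) : Set (Fin (n + n₀) → 𝒳))) (by
        refine ne_top_of_le_ne_top ((summable_nat_add_iff n₀).2 hsummable).tsum_ofReal_ne_top
          (ENNReal.tsum_le_tsum fun n => hn₀ _ (Nat.le_add_left _ _)))
    filter_upwards [hbc] with ω hω
    obtain ⟨m, hm⟩ := eventually_atTop.1 hω
    filter_upwards [eventually_ge_atTop (m + n₀)] with n hn
    have := hm (n - n₀) (by omega)
    rw [Nat.sub_add_cancel (by omega)] at this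
    simpa [S] using this
  -- Countably many tolerances suffice and allow a single null set.
  have hall : ∀ᵐ ω ∂μ, ∀ i, ∀ j : ℕ, ∀ᶠ n : ℕ in atTop,
      |(count (X n ω) i : ℝ) - n * (rN n i / N n)| < 1 / ((j : ℝ) + 1) * n :=
    ae_all_iff.2 fun i => ae_all_iff.2 fun j => hdev i _ (by positivity)
  filter_upwards [hall] with ω hω i
  have h0 : Tendsto (fun n : ℕ => (count (X n ω) i : ℝ) / n - rN n i / N n) atTop (𝓝 0) := by
    rw [Metric.tendsto_nhds]
    intro ε hε
    obtain ⟨j, hj⟩ := exists_nat_one_div_lt hε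
    filter_upwards [hω i j, eventually_gt_atTop 0] with n h1 hn
    have hn' : (0 : ℝ) < n := by exact_mod_cast hn
    have e : (count (X n ω) i : ℝ) / n - rN n i / N n =
        ((count (X n ω) i : ℝ) - n * (rN n i / N n)) / n := by field_simp
    rw [Real.dist_eq, sub_zero, e, abs_div, abs_of_pos hn', div_lt_iff₀ hn']
    exact h1.trans (by gcongr)
  simpa using h0.add (hrlim i)

/-! ### The posterior -/

lemma polyaLSet_eq {β : ℝ} {c : ℤ} {A : Set (stdSimplex ℝ 𝒳)} {r : stdSimplex ℝ 𝒳}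
    (h : ∀ q ∈ A, polyaL β c q r = -rate β c r q - 1) {s : ℝ} (hs : IsLUB (rate β c r '' A) s) :
    polyaLSet β c A r = ((-s - 1 : ℝ) : EReal) := by
  refine le_antisymm (EReal.le_of_forall_lt_iff_le.1 fun z hz => ?_)
    (le_iInf₂ fun q hq => ?_)
  · rw [EReal.coe_lt_coe_iff] at hz
    obtain ⟨_, ⟨q, hq, rfl⟩, hqz⟩ := (lt_isLUB_iff hs).1 (show -z - 1 < s by linarith)
    refine iInf₂_le_of_le q hq ?_
    rw [h q hq, EReal.coe_le_coe_iff]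
    linarith
  · rw [h q hq, EReal.coe_le_coe_iff]
    linarith [hs.1 ⟨q, hq, rfl⟩]

/-- If sampling is meaningful for all configurations of the model, then the proportions of the
model exceed the fraction that sampling may remove. -/
lemma neg_mul_le_of_meaningful {c : ℤ} {β : ℝ}
    {N : ℕ → ℕ} (hN : Tendsto (fun n : ℕ => (n : ℝ) / (N n : ℝ)) atTop (𝓝 β))
    (hN0 : ∀ᶠ n in atTop, 0 < N n)
    {Φ : Set (stdSimplex ℝ 𝒳)} (hΦo : IsOpen Φ)
    (hmΦ : ∀ᶠ n in atTop, ∀ α ∈ configs Φ (N n), Meaningful c n α)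
    {π : ℕ → PMF (𝒳 → ℕ)}
    (hπ' : ∀ G ⊆ Φ, IsOpen G → G.Nonempty → ∀ ε : ℝ, 0 < ε →
      ∀ᶠ n : ℕ in atTop, Real.exp (-(ε * n)) ≤ priorMass (π n) (N n) G)
    {q : stdSimplex ℝ 𝒳} (hq : q ∈ Φ) (i : 𝒳) : -(β * c) ≤ (q : 𝒳 → ℝ) i := by
  by_contra! hlt
  obtain ⟨b, hqb, hb⟩ := exists_between hlt
  -- If `q i < b < -(β * c)`, this open set has positive prior mass and so contains configurations
  -- with `α i / N < b`, whereas meaningfulness forces `α i / N ≥ -(n / N) * c`, which eventually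
  -- exceeds `b`.
  let G := Φ ∩ {q' : stdSimplex ℝ 𝒳 | (q' : 𝒳 → ℝ) i < b}
  have hGo : IsOpen G := hΦo.inter (isOpen_lt
    ((continuous_apply i).comp continuous_subtype_val) continuous_const)
  obtain ⟨n, h1, h2, h3, h4⟩ := ((hπ' G Set.inter_subset_left hGo ⟨q, hq, hqb⟩ 1 one_pos).and
    (hmΦ.and (hN0.and ((hN.mul_const (c : ℝ)).neg.eventually_const_lt hb)))).exists
  have hne : (configs G (N n)).Nonempty := by
    by_contra he
    rw [Finset.not_nonempty_iff_eq_empty] at he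
    rw [priorMass, he, Finset.sum_empty] at h1
    exact (Real.exp_pos _).not_ge h1
  obtain ⟨α, hα⟩ := hne
  obtain ⟨hsum, q', hq', hqα⟩ := mem_configs.1 hα
  have h5 := (h2 α (mem_configs.2 ⟨hsum, q', hq'.1, hqα⟩)).nonneg le_rfl i
  have h6 : (q' : 𝒳 → ℝ) i < b := hq'.2
  have hN' : (0 : ℝ) < N n := by exact_mod_cast h3
  rw [hqα] at h6
  have h7 : (α i : ℝ) / N n + n / N n * c = ((α i : ℝ) + n * c) / N n := by ring
  have h8 := div_nonneg h5 hN'.le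
  linarith

/-- Serves the one-colour case, where `r i = 1` and the general argument fails for `c < 0`. -/
lemma posterior_self {c : ℤ} [Nonempty 𝒳] {π : PMF (𝒳 → ℕ)} {N n : ℕ}
    {Φ : Set (stdSimplex ℝ 𝒳)} (hΦ : Φ ⊆ fullSupport 𝒳)
    (hm : ∀ α ∈ configs Φ N, Meaningful c n α) (hπ : 0 < priorMass π N Φ) (x : Fin n → 𝒳) :
    posterior c π N Φ Φ x = 1 := by
  refine div_self (ne_of_gt ?_)
  obtain ⟨α, hα, hα0⟩ := Finset.exists_lt_of_sum_lt (s := configs Φ N) (f := fun _ => (0 : ℝ))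
    (g := fun α => (π α).toReal) (by rw [Finset.sum_const_zero]; exact hπ)
  exact Finset.sum_pos'
    (fun α hα => mul_nonneg ENNReal.toReal_nonneg
      (sampleProb_pos (hm α hα) (pos_of_mem_configs hΦ hα) x).le)
    ⟨α, hα, mul_pos hα0 (sampleProb_pos (hm α hα) (pos_of_mem_configs hΦ hα) x)⟩

/-- The logarithmic asymptotics of the posterior along a fixed sequence of samples whose
frequencies converge to `r`. -/
lemma tendsto_log_posterior {c : ℤ} {β : ℝ} (hβ : 0 < β)
    {N : ℕ → ℕ} (hN : Tendsto (fun n : ℕ => (n : ℝ) / (N n : ℝ)) atTop (𝓝 β))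
    {Φ Q : Set (stdSimplex ℝ 𝒳)} (hΦ : Φ ⊆ fullSupport 𝒳) (hΦo : IsOpen Φ) (hQΦ : Q ⊆ Φ)
    (hQo : IsOpen Q)
    {r : stdSimplex ℝ 𝒳} (hr : r ∈ fullSupport 𝒳) (hr1 : ∀ i, (r : 𝒳 → ℝ) i < 1 ∨ 0 ≤ c)
    (hmΦ : ∀ᶠ n in atTop, ∀ α ∈ configs Φ (N n), Meaningful c n α)
    {π : ℕ → PMF (𝒳 → ℕ)}
    (hπ' : ∀ G ⊆ Φ, IsOpen G → G.Nonempty → ∀ ε : ℝ, 0 < ε →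
      ∀ᶠ n : ℕ in atTop, Real.exp (-(ε * n)) ≤ priorMass (π n) (N n) G)
    {x : (n : ℕ) → Fin n → 𝒳}
    (hx : ∀ i, Tendsto (fun n => (count (x n) i : ℝ) / n) atTop (𝓝 ((r : 𝒳 → ℝ) i)))
    {sQ sΦ : ℝ} (hsQ : IsLUB (rate β c r '' Q) sQ) (hsΦ : IsLUB (rate β c r '' Φ) sΦ) :
    (∀ᶠ n in atTop, 0 < posterior c (π n) (N n) Φ Q (x n)) ∧
    Tendsto (fun n : ℕ => 1 / (n : ℝ) * Real.log (posterior c (π n) (N n) Φ Q (x n))) atTop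
      (𝓝 (sQ - sΦ)) := by
  have : Nonempty 𝒳 := by
    by_contra h
    rw [not_nonempty_iff] at h
    simpa using r.2.2
  have hN0 : ∀ᶠ n in atTop, 0 < N n := by
    filter_upwards [hN.eventually_const_lt hβ] with n h
    rcases Nat.eq_zero_or_pos (N n) with h0 | h0
    · simp [h0] at h
    · exact h0
  have hf : ∀ ε : ℝ, 0 < ε → ∀ᶠ n in atTop, ∀ α ∈ configs Φ (N n), ∀ q : stdSimplex ℝ 𝒳,
      (∀ i, (q : 𝒳 → ℝ) i = (α i : ℝ) / N n) →
      |logLik c (N n) n (count (x n)) α - rate β c r q| ≤ ε * (1 + |rate β c r q|) := by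
    intro ε hε
    by_cases hc : c = 0
    · subst hc
      filter_upwards [logLik_uniform_zero (β := β) hN0 hΦ hr (fun n => sum_count (x n)) hx hε]
        with n h α hα q hq
      exact (h α hα q hq).trans (by gcongr; linarith)
    · filter_upwards [logLik_uniform_of_ne hc hβ hN hΦ hmΦ hr1 (fun n => sum_count (x n)) hx hε]
        with n h α hα q hq
      refine (h α hα q hq).trans ?_
      have := mul_nonneg hε.le (abs_nonneg (rate β c r q))
      linarith
  have hFc := (continuousOn_rate β c r).mono hΦ
  obtain ⟨pQ, lQ⟩ := tendsto_log_sum_configs hQΦ hQo hπ' hFc hsQ hf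
  obtain ⟨pΦ, lΦ⟩ := tendsto_log_sum_configs subset_rfl hΦo hπ' hFc hsΦ hf
  have hpost : ∀ᶠ n in atTop, posterior c (π n) (N n) Φ Q (x n) =
      (∑ α ∈ configs Q (N n), (π n α).toReal *
        Real.exp (n * logLik c (N n) n (count (x n)) α)) /
      ∑ α ∈ configs Φ (N n), (π n α).toReal *
        Real.exp (n * logLik c (N n) n (count (x n)) α) := by
    filter_upwards [hmΦ, hN0, eventually_ne_atTop 0, pΦ] with n hm hN0 hn hp
    have hQΦn : ∀ α ∈ configs Q (N n), α ∈ configs Φ (N n) := fun α hα => by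
      obtain ⟨h1, q, hq, h2⟩ := mem_configs.1 hα
      exact mem_configs.2 ⟨h1, q, hQΦ hq, h2⟩
    obtain ⟨α₀, hα₀⟩ : (configs Φ (N n)).Nonempty := by
      by_contra he
      rw [Finset.not_nonempty_iff_eq_empty] at he
      simp [he] at hp
    set κ := Real.exp (n * Real.log (N n)) / ∏ l ∈ Finset.range n, ((N n : ℝ) + l * c) with hκ
    have hlik : ∀ α ∈ configs Φ (N n), sampleProb c α (x n) =
        Real.exp (n * logLik c (N n) n (count (x n)) α) * κ := fun α hα =>
      log_sampleProb (hm α hα) (pos_of_mem_configs hΦ hα) hn (mem_configs.1 hα).1 _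
    have hκ0 : κ ≠ 0 := by
      have := sampleProb_pos (hm α₀ hα₀) (pos_of_mem_configs hΦ hα₀) (x n)
      rw [hlik α₀ hα₀] at this
      exact right_ne_zero_of_mul this.ne'
    rw [posterior, Finset.sum_congr rfl fun α hα => by rw [hlik α (hQΦn α hα), ← mul_assoc],
      Finset.sum_congr (s₁ := configs Φ (N n)) rfl
        fun α hα => by rw [hlik α hα, ← mul_assoc],
      ← Finset.sum_mul, ← Finset.sum_mul, mul_div_mul_right _ _ hκ0]
  constructor
  · filter_upwards [hpost, pQ, pΦ] with n h hq hp
    rw [h]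
    exact div_pos hq hp
  · refine (lQ.sub lΦ).congr' ?_
    filter_upwards [hpost, pQ, pΦ] with n h hq hp
    rw [h, Real.log_div hq.ne' hp.ne', mul_sub]

end PolyaUrn

theorem theorem2p4 {𝒳 : Type*} [Fintype 𝒳] [DecidableEq 𝒳]
    [MeasurableSpace 𝒳] [MeasurableSingletonClass 𝒳]
    (c : ℤ) (β : ℝ) (hβ0 : 0 < β) (hβ1 : β < 1)
    -- the size of the urn from which the sample of size `n` is drawn
    (N : ℕ → ℕ) (hN : Tendsto (fun n : ℕ => (n : ℝ) / (N n : ℝ)) atTop (𝓝 β))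
    -- the sets of proportions
    (Φ Q : Set (stdSimplex ℝ 𝒳))
    (hΦ : Φ ⊆ PolyaUrn.fullSupport 𝒳) (hΦo : IsOpen Φ) (hQΦ : Q ⊆ Φ) (hQo : IsOpen Q)
    -- the true initial configurations converge to `r` in total variation
    (r : stdSimplex ℝ 𝒳) (hr : r ∈ PolyaUrn.fullSupport 𝒳)
    (rN : ℕ → 𝒳 → ℕ) (hrN : ∀ n, ∑ i, rN n i = N n)
    (hrlim : Tendsto
      (fun n => (1 / 2 : ℝ) * ∑ i, |(rN n i : ℝ) / (N n : ℝ) - (r : 𝒳 → ℝ) i|) atTop (𝓝 0))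
    -- sampling is meaningful for the true configuration and for the model
    (hmr : ∀ᶠ n in atTop, PolyaUrn.Meaningful c n (rN n))
    (hmΦ : ∀ᶠ n in atTop, ∀ α ∈ PolyaUrn.configs Φ (N n), PolyaUrn.Meaningful c n α)
    -- the priors: their support is `Φ(N)`, and no nonempty open part of `Φ` has exponentially
    -- small prior probability
    (π : ℕ → PMF (𝒳 → ℕ))
    (hπ : ∀ᶠ n in atTop, (π n).support = (PolyaUrn.configs Φ (N n) : Set (𝒳 → ℕ)))
    (hπ' : ∀ G ⊆ Φ, IsOpen G → G.Nonempty → ∀ ε : ℝ, 0 < ε →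
      ∀ᶠ n : ℕ in atTop, Real.exp (-(ε * n)) ≤ PolyaUrn.priorMass (π n) (N n) G)
    -- the samples, with an arbitrary joint distribution for different `n`
    {Ω : Type*} [MeasurableSpace Ω] (μ : Measure Ω) [IsProbabilityMeasure μ]
    (X : (n : ℕ) → Ω → Fin n → 𝒳) (hXm : ∀ n, Measurable (X n))
    (hX : ∀ᶠ n in atTop, ∀ x : Fin n → 𝒳,
      μ.real (X n ⁻¹' {x}) = PolyaUrn.sampleProb c (rN n) x)
    (hL : PolyaUrn.polyaLSet β c Q r < ⊤) :
    ∀ᵐ ω ∂μ,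
      (∀ᶠ n in atTop, 0 < PolyaUrn.posterior c (π n) (N n) Φ Q (X n ω)) ∧
      Tendsto
        (fun n : ℕ => (((1 / (n : ℝ)) *
          Real.log (PolyaUrn.posterior c (π n) (N n) Φ Q (X n ω)) : ℝ) : EReal))
        atTop
        (𝓝 (-(PolyaUrn.polyaLSet β c Q r - PolyaUrn.polyaLSet β c Φ r))) := by
  have hne : Nonempty 𝒳 := by
    by_contra h
    rw [not_nonempty_iff] at h
    simpa using r.2.2
  -- Finiteness of the divergence of `Q` excludes the empty infimum `⊤`.
  have hQ : Q.Nonempty := by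
    by_contra h
    rw [Set.not_nonempty_iff_eq_empty] at h
    simp [PolyaUrn.polyaLSet, h] at hL
  have hN0 : ∀ᶠ n in atTop, 0 < N n := by
    filter_upwards [hN.eventually_const_lt hβ0] with n h
    rcases Nat.eq_zero_or_pos (N n) with h0 | h0
    · simp [h0] at h
    · exact h0
  rcases subsingleton_or_nontrivial 𝒳 with hsub | hnt
  · -- with one colour the model is a single point
    have hss : ∀ q : stdSimplex ℝ 𝒳, q = r := fun q => by
      refine Subtype.ext (funext fun i => ?_)
      have h : ∀ p : stdSimplex ℝ 𝒳, (p : 𝒳 → ℝ) i = 1 := fun p => by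
        have := p.2.2
        rwa [Fintype.sum_subsingleton _ i] at this
      exact (h q).trans (h r).symm
    have hall : ∀ A : Set (stdSimplex ℝ 𝒳), A.Nonempty → A = {r} := fun A hA =>
      Set.eq_singleton_iff_nonempty_unique_mem.2 ⟨hA, fun q _ => hss q⟩
    obtain rfl : Q = Φ := (hall Q hQ).trans (hall Φ (hQ.mono hQΦ)).symm
    have hpost : ∀ᶠ n in atTop, ∀ x : Fin n → 𝒳,
        PolyaUrn.posterior c (π n) (N n) Q Q x = 1 := by
      filter_upwards [hmΦ, hπ' Q subset_rfl hQo hQ 1 one_pos] with n h1 h2 x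
      exact PolyaUrn.posterior_self hΦ h1 ((Real.exp_pos _).trans_le h2) x
    have hval : PolyaUrn.polyaLSet β c Q r = (PolyaUrn.polyaL β c r r : EReal) := by
      rw [hall Q hQ]
      simp [PolyaUrn.polyaLSet]
    refine Eventually.of_forall fun ω => ⟨?_, ?_⟩
    · filter_upwards [hpost] with n h
      rw [h]
      exact one_pos
    · rw [hval, ← EReal.coe_sub, sub_self, EReal.coe_zero, neg_zero]
      refine tendsto_const_nhds.congr' ?_
      filter_upwards [hpost] with n h
      rw [h]
      simp
  · have hr1 : ∀ i, (r : 𝒳 → ℝ) i < 1 := fun i => by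
      obtain ⟨j, hj⟩ := exists_ne i
      have h1 := Finset.add_le_sum (f := (r : 𝒳 → ℝ)) (fun k _ => r.2.1 k)
        (Finset.mem_univ i) (Finset.mem_univ j) hj.symm
      have h2 : ∑ k, (r : 𝒳 → ℝ) k = 1 := r.2.2
      have h3 := hr j
      linarith
    have hrlim' : ∀ i, Tendsto (fun n => (rN n i : ℝ) / (N n : ℝ)) atTop
        (𝓝 ((r : 𝒳 → ℝ) i)) := fun i => by
      rw [tendsto_iff_dist_tendsto_zero]
      have h2 := hrlim.const_mul 2
      rw [mul_zero] at h2
      refine squeeze_zero (fun _ => dist_nonneg) (fun n => ?_) h2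
      have := Finset.single_le_sum (f := fun j => |(rN n j : ℝ) / (N n : ℝ) - (r : 𝒳 → ℝ) j|)
        (fun j _ => abs_nonneg _) (Finset.mem_univ i)
      rw [Real.dist_eq]
      linarith
    have hL' : ∀ q ∈ Φ, PolyaUrn.polyaL β c q r = -PolyaUrn.rate β c r q - 1 := fun q hq => by
      refine PolyaUrn.polyaL_eq hβ0.ne' c (hΦ hq) fun i => ?_
      rcases le_or_gt 0 c with hc | hc
      · have hc' : (0 : ℝ) ≤ c := by exact_mod_cast hc
        have := hΦ hq i
        have h2 := hr i
        positivity
      · have hc' : (c : ℝ) < 0 := by exact_mod_cast hc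
        have h1 := PolyaUrn.neg_mul_le_of_meaningful hN hN0 hΦo hmΦ hπ' hq i
        -- From `q i ≥ -β c` and `r i < 1`: `q i + β c r i ≥ β (-c) (1 - r i) > 0`.
        have h2 := mul_pos (mul_pos hβ0 (neg_pos.2 hc')) (sub_pos.2 (hr1 i))
        linarith
    have hlub : ∀ A : Set (stdSimplex ℝ 𝒳), A.Nonempty →
        IsLUB (PolyaUrn.rate β c r '' A) (sSup (PolyaUrn.rate β c r '' A)) := fun A hA =>
      isLUB_csSup (hA.image _) ((PolyaUrn.bddAbove_rate β c hr).mono (Set.image_subset_range _ _))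
    have hsQ := hlub Q hQ
    have hsΦ := hlub Φ (hQ.mono hQΦ)
    rw [PolyaUrn.polyaLSet_eq (fun q hq => hL' q (hQΦ hq)) hsQ, PolyaUrn.polyaLSet_eq hL' hsΦ,
      ← EReal.coe_sub, ← EReal.coe_neg]
    filter_upwards [PolyaUrn.ae_tendsto_count_div hβ0 hβ1
      (fun _ => Fintype.one_lt_card_iff_nontrivial.2 hnt) hN hrN hrlim' hmr μ hXm hX] with ω hω
    obtain ⟨h1, h2⟩ := PolyaUrn.tendsto_log_posterior hβ0 hN hΦ hΦo hQΦ hQo hr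
      (fun i => Or.inl (hr1 i)) hmΦ hπ' hω hsQ hsΦ
    refine ⟨h1, EReal.tendsto_coe.2 ?_⟩
    convert h2 using 2
    ring
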